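/- For every integer $n \ge 0$, the polynomial $$B_n(q)=\prod_{k=0}^{n}(1+q^{3k+1})(1+q^{3k+2})=\sum_{m=0}^{d_n}a_n(m)\,q^m$$ has degree $d_n=3(n+1)^2$ and is symmetric and unimodal; that is, $a_n(m)=a_n(d_n-m)$ for all $0\le m\le d_n$, and there is an index $0\le j\le d_n$ such that $$a_n(0)\le a_n(1)\le\cdots\le a_n(j)\ge a_n(j+1)\ge\cdots\ge a_n(d_n).$$ -/

import Mathlib

open Polynomial

/-- The polynomial `∏_{k=0}^{n} (1 + q^(3k+1)) (1 + q^(3k+2))` with integer coefficients. -/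
noncomputable def partitionPoly (n : ℕ) : ℤ[X] :=
  ∏ k ∈ Finset.range (n + 1), ((1 + X ^ (3 * k + 1)) * (1 + X ^ (3 * k + 2)))

/-- A polynomial `a_0 + a_1 q + ⋯ + a_N q^N` of degree `N` is symmetric if
`a_j = a_{N-j}` for all `0 ≤ j ≤ N`. -/
def SymmetricPoly (p : ℤ[X]) : Prop :=
  ∀ j : ℕ, j ≤ p.natDegree → p.coeff j = p.coeff (p.natDegree - j)

/-- A polynomial `a_0 + a_1 q + ⋯ + a_N q^N` of degree `N` is unimodal if for some `0 ≤ j ≤ N`,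
`a_0 ≤ a_1 ≤ ⋯ ≤ a_j ≥ a_{j+1} ≥ ⋯ ≥ a_N`. -/
def UnimodalPoly (p : ℤ[X]) : Prop :=
  ∃ j : ℕ, j ≤ p.natDegree ∧
    (∀ i : ℕ, i < j → p.coeff i ≤ p.coeff (i + 1)) ∧
    (∀ i : ℕ, j ≤ i → i < p.natDegree → p.coeff (i + 1) ≤ p.coeff i)

/-! With q = z², centering turns the k-th factor into z + z⁻¹ + z^(6k+3) + z^(-(6k+3)). So at level
N+1 the difference c(y-1) - c(y+1) is the sum of four such differences at level N, taken at y ± 1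
and y ± (6N+3). If y ≥ 6N+3, all four are nonnegative by induction; only a central window needs a
separate argument (`centeredCoeff_antitone`).

For N < 60 the window is computed. For N ≥ 60 the difference is a positive multiple of the integral
of P(θ) sin(yθ) sin θ over [0, π], with P = `cosProd N`, and symmetry reduces its sign to that over
[0, π/2]. The integrand is nonnegative up to π/(6N), and [1/N², 2/N²] alone contributes at least a
constant times N⁻⁶. Beyond π/(6N), AM-GM and a closed-form cosine sum give |P| ≤ (5/8)^N, which is
too small to compensate (`half_integral_nonneg`). -/

/-! ### Centered coefficients and reduction to the central window -/

/-- The coefficients of `∏_{k<N} (1+q^(3k+1))(1+q^(3k+2))` after centering: the coefficient of `q^m`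
is `centeredCoeff N (2m - 3N²)`. -/
def centeredCoeff : ℕ → ℤ → ℤ
  | 0, x => if x = 0 then 1 else 0
  | N + 1, x => centeredCoeff N (x + 1) + centeredCoeff N (x - 1) +
      centeredCoeff N (x + (6 * N + 3)) + centeredCoeff N (x - (6 * N + 3))

theorem centeredCoeff_neg (N : ℕ) (x : ℤ) : centeredCoeff N (-x) = centeredCoeff N x := by
  induction N generalizing x with
  | zero => simp [centeredCoeff]
  | succ N ih =>
    simp only [centeredCoeff]
    rw [← ih (x + 1), ← ih (x - 1), ← ih (x + (6 * N + 3)), ← ih (x - (6 * N + 3))]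
    rw [show -x + 1 = -(x - 1) by ring, show -x - 1 = -(x + 1) by ring,
      show -x + (6 * N + 3) = -(x - (6 * N + 3)) by ring,
      show -x - (6 * N + 3) = -(x + (6 * N + 3)) by ring]
    ring

theorem centeredCoeff_eq_zero_of_odd (N : ℕ) (x : ℤ) (h : ¬ 2 ∣ x + N) :
    centeredCoeff N x = 0 := by
  induction N generalizing x with
  | zero =>
    have : x ≠ 0 := by rintro rfl; simp at h
    simp [centeredCoeff, this]
  | succ N ih =>
    push_cast at h
    simp only [centeredCoeff]
    rw [ih, ih, ih, ih] <;> first | rfl | omega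

theorem centeredCoeff_eq_zero_of_lt (N : ℕ) (x : ℤ) (h : x < -(3 * N ^ 2)) :
    centeredCoeff N x = 0 := by
  induction N generalizing x with
  | zero =>
    have : x ≠ 0 := by rintro rfl; simp at h
    simp [centeredCoeff, this]
  | succ N ih =>
    push_cast at h
    simp only [centeredCoeff]
    rw [ih, ih, ih, ih] <;> first | rfl | nlinarith [Int.natCast_nonneg N]

theorem coeff_prod_eq_centeredCoeff (N m : ℕ) :
    (∏ k ∈ Finset.range N, ((1 + X ^ (3 * k + 1)) * (1 + X ^ (3 * k + 2))) : ℤ[X]).coeff m =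
      centeredCoeff N (2 * m - 3 * N ^ 2) := by
  induction N generalizing m with
  | zero => simp [centeredCoeff, coeff_one]
  | succ N ih =>
    rw [Finset.prod_range_succ]
    set p : ℤ[X] := ∏ k ∈ Finset.range N, ((1 + X ^ (3 * k + 1)) * (1 + X ^ (3 * k + 2)))
    have e : p * ((1 + X ^ (3 * N + 1)) * (1 + X ^ (3 * N + 2))) =
        p + p * X ^ (3 * N + 1) + p * X ^ (3 * N + 2) + p * X ^ (6 * N + 3) := by ring
    have key : ∀ (d : ℕ) (z : ℤ), z = 2 * m - 3 * N ^ 2 - 2 * d →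
        (p * X ^ d).coeff m = centeredCoeff N z := by
      intro d z hz
      rw [coeff_mul_X_pow']
      split_ifs with h
      · rw [ih, hz]; congr 1; push_cast [h]; ring
      · rw [centeredCoeff_eq_zero_of_lt]
        push Not at h
        have : (m : ℤ) < d := by exact_mod_cast h
        linarith
    rw [e, coeff_add, coeff_add, coeff_add]
    simp only [centeredCoeff]
    rw [key (3 * N + 1) (2 * m - 3 * (N + 1 : ℕ) ^ 2 + 1) (by push_cast; ring),
      key (3 * N + 2) (2 * m - 3 * (N + 1 : ℕ) ^ 2 - 1) (by push_cast; ring),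
      key (6 * N + 3) (2 * m - 3 * (N + 1 : ℕ) ^ 2 - (6 * N + 3)) (by push_cast; ring), ih]
    rw [show (2 * m - 3 * (N + 1 : ℕ) ^ 2 + (6 * N + 3) : ℤ) = 2 * m - 3 * N ^ 2 by
      push_cast; ring]
    ring

/-- Unimodality of all the centered sequences follows from unimodality on a central window. -/
theorem centeredCoeff_antitone
    (window : ∀ N : ℕ, ∀ y : ℕ, 1 ≤ y → y + 3 < 6 * N →
      centeredCoeff N (y + 1) ≤ centeredCoeff N (y - 1)) (N : ℕ) (y : ℕ) :
    centeredCoeff N (y + 1) ≤ centeredCoeff N (y - 1) := by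
  induction N generalizing y with
  | zero =>
    have : (y : ℤ) + 1 ≠ 0 := by positivity
    simp only [centeredCoeff, this, if_false]
    split_ifs <;> simp
  | succ N ih =>
    rcases Nat.eq_zero_or_pos y with rfl | hy
    · simpa using (centeredCoeff_neg (N + 1) 1).ge
    by_cases h : y + 3 < 6 * (N + 1)
    · exact window _ _ hy h
    -- Outside the window y ≥ 6N+3, so y - (6N+3) is still a natural number and the induction
    -- hypothesis covers all four shifts.
    · obtain ⟨z, rfl⟩ : ∃ z, y = z + (6 * N + 3) := ⟨y - (6 * N + 3), by omega⟩
      have h1 := ih (z + (6 * N + 3) + 1)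
      have h2 := ih (z + (6 * N + 3) - 1)
      have h3 := ih (z + (6 * N + 3) + (6 * N + 3))
      have h4 := ih z
      rw [Nat.cast_sub (by omega)] at h2
      simp only [centeredCoeff]
      push_cast at *
      ring_nf at *
      linarith

theorem partitionPoly_coeff (n m : ℕ) :
    (partitionPoly n).coeff m = centeredCoeff (n + 1) (2 * m - 3 * (n + 1) ^ 2) := by
  have := coeff_prod_eq_centeredCoeff (n + 1) m
  push_cast at this
  exact this

theorem partitionPoly_natDegree (n : ℕ) : (partitionPoly n).natDegree = 3 * (n + 1) ^ 2 := by
  have h : ∀ k : ℕ, 0 < k → (1 + X ^ k : ℤ[X]).Monic := fun k hk => by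
    rw [add_comm]; exact monic_X_pow_add_C 1 hk.ne'
  have hd : ∀ k : ℕ, (1 + X ^ k : ℤ[X]).natDegree = k := fun k => by
    rw [add_comm]; exact natDegree_X_pow_add_C
  unfold partitionPoly
  rw [natDegree_prod_of_monic _ _ fun k _ => (h _ (by omega)).mul (h _ (by omega))]
  simp_rw [(h _ (Nat.succ_pos _)).natDegree_mul (h _ (Nat.succ_pos _)), hd]
  induction n with
  | zero => simp
  | succ n ih => rw [Finset.sum_range_succ, ih]; simp only [Nat.succ_eq_add_one]; ring

theorem theorem1_of_window
    (window : ∀ N : ℕ, ∀ y : ℕ, 1 ≤ y → y + 3 < 6 * N →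
      centeredCoeff N (y + 1) ≤ centeredCoeff N (y - 1)) (n : ℕ) :
    (partitionPoly n).natDegree = 3 * (n + 1) ^ 2 ∧
      SymmetricPoly (partitionPoly n) ∧ UnimodalPoly (partitionPoly n) := by
  have hd := partitionPoly_natDegree n
  refine ⟨hd, ?_, 3 * (n + 1) ^ 2 / 2, ?_, ?_, ?_⟩
  · intro j hj
    rw [partitionPoly_coeff, partitionPoly_coeff, ← centeredCoeff_neg, hd, Nat.cast_sub (hd ▸ hj)]
    congr 1
    push_cast
    ring
  · rw [hd]; exact Nat.div_le_self _ _
  · intro i hi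
    obtain ⟨y, hy⟩ : ∃ y, 3 * (n + 1) ^ 2 = 2 * i + 1 + y := ⟨3 * (n + 1) ^ 2 - (2 * i + 1), by omega⟩
    have h := centeredCoeff_antitone window (n + 1) y
    zify at hy
    rw [← centeredCoeff_neg, ← centeredCoeff_neg (n + 1) (y - 1)] at h
    rw [partitionPoly_coeff, partitionPoly_coeff, hy]
    push_cast
    ring_nf at *
    exact h
  · intro i hi _
    obtain ⟨y, hy⟩ : ∃ y, 2 * i + 1 = 3 * (n + 1) ^ 2 + y := ⟨(2 * i + 1) - 3 * (n + 1) ^ 2, by omega⟩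
    have h := centeredCoeff_antitone window (n + 1) y
    zify at hy
    rw [partitionPoly_coeff, partitionPoly_coeff]
    push_cast
    rw [show (2 * ((i : ℤ) + 1) - 3 * (n + 1) ^ 2) = y + 1 by linarith,
      show (2 * (i : ℤ) - 3 * (n + 1) ^ 2) = y - 1 by linarith]
    exact h

/-! ### The window for N < 60, by computation -/

/-- Kronecker substitution: coefficients below B are the base-B digits of the value at B, so one
integer encodes the whole polynomial. -/
theorem eval_div_pow_mod_eq_coeff (B : ℕ) (p : ℕ[X]) (hp : ∀ m, p.coeff m < B) (m : ℕ) :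
    p.eval B / B ^ m % B = p.coeff m := by
  have hB : 0 < B := (Nat.zero_le _).trans_lt (hp 0)
  have e : ∀ p : ℕ[X], p.eval B = B * p.divX.eval B + p.coeff 0 := fun p => by
    conv_lhs => rw [← divX_mul_X_add p]
    simp [mul_comm]
  induction m generalizing p with
  | zero => rw [e, pow_zero, Nat.div_one, Nat.mul_add_mod, Nat.mod_eq_of_lt (hp 0)]
  | succ m ih =>
    have := ih p.divX (fun k => by rw [coeff_divX]; exact hp _)
    rw [coeff_divX] at this
    rw [← this, pow_succ', ← Nat.div_div_eq_div_mul, e, Nat.mul_add_div hB,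
      Nat.div_eq_of_lt (hp 0), add_zero]

/-- The first `c + 1` base-`B` digits of `V` are nondecreasing. -/
def digitsMonotone (B : ℕ) : ℕ → ℕ → Bool
  | 0, _ => true
  | c + 1, V => Nat.ble (V % B) (V / B % B) && digitsMonotone B c (V / B)

theorem digitsMonotone_spec {B c V : ℕ} (h : digitsMonotone B c V = true) {i : ℕ} (hi : i < c) :
    V / B ^ i % B ≤ V / B ^ (i + 1) % B := by
  induction c generalizing V i with
  | zero => omega
  | succ c ih =>
    simp only [digitsMonotone, Bool.and_eq_true, Nat.ble_eq] at h
    cases i with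
    | zero => simpa using h.1
    | succ i =>
      have := ih h.2 (i := i) (by omega)
      rwa [Nat.div_div_eq_div_mul, Nat.div_div_eq_div_mul, ← pow_succ', ← pow_succ'] at this

/-- Checks, for `fuel` consecutive values of `N`, that the base-`B` digits of `K`, the value at `B` of
the `N`-th product, increase on the central window. -/
def windowCheck (B : ℕ) : ℕ → ℕ → ℕ → Bool
  | 0, _, _ => true
  | fuel + 1, N, K =>
    digitsMonotone B (3 * N ^ 2 / 2 - 3 * (N - 1) ^ 2 / 2) (K / B ^ (3 * (N - 1) ^ 2 / 2)) &&
      windowCheck B fuel (N + 1) (K * ((1 + B ^ (3 * N + 1)) * (1 + B ^ (3 * N + 2))))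

theorem windowCheck_spec {B fuel M : ℕ} {F : ℕ → ℕ}
    (hF : ∀ N, F (N + 1) = F N * ((1 + B ^ (3 * N + 1)) * (1 + B ^ (3 * N + 2))))
    (h : windowCheck B fuel M (F M) = true) {N : ℕ} (h1 : M ≤ N) (h2 : N < M + fuel) :
    digitsMonotone B (3 * N ^ 2 / 2 - 3 * (N - 1) ^ 2 / 2)
      (F N / B ^ (3 * (N - 1) ^ 2 / 2)) = true := by
  induction fuel generalizing M with
  | zero => omega
  | succ fuel ih =>
    simp only [windowCheck, Bool.and_eq_true, ← hF] at h
    rcases h1.eq_or_lt with rfl | h1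
    · exact h.1
    · exact ih h.2 h1 (by omega)

theorem windowCheck_sixty : windowCheck (2 ^ 120) 60 0 1 = true := by
  decide +kernel

theorem centeredCoeff_window_of_lt_sixty (N y : ℕ) (hN : N < 60) (hy : 1 ≤ y) (hyN : y + 3 < 6 * N) :
    centeredCoeff N (y + 1) ≤ centeredCoeff N (y - 1) := by
  by_cases par : (2 : ℤ) ∣ y + 1 + N
  swap
  · rw [centeredCoeff_eq_zero_of_odd N (y + 1) par, centeredCoeff_eq_zero_of_odd N (y - 1) (by omega)]
  let p : ℕ → ℕ[X] := fun N => ∏ k ∈ Finset.range N, ((1 + X ^ (3 * k + 1)) * (1 + X ^ (3 * k + 2)))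
  have hp1 : ∀ N m, ((p N).coeff m : ℤ) = centeredCoeff N (2 * m - 3 * N ^ 2) := by
    intro N m
    rw [← coeff_prod_eq_centeredCoeff]
    have := coeff_map (Nat.castRingHom ℤ) (p := p N) m
    simp only [eq_natCast] at this
    rw [← this]
    simp [p, Polynomial.map_prod]
  -- Each coefficient is at most the value at 1, which is 4^N < 4^60 = 2^120; hence the choice of
  -- base.
  have hp2 : ∀ m, (p N).coeff m < 2 ^ 120 := by
    intro m
    have h1 : (p N).eval 1 = 4 ^ N := by
      simp [p, eval_prod]
    have h2 : (p N).coeff m ≤ (p N).eval 1 := by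
      rw [eval_eq_sum]
      simp only [one_pow, mul_one, Polynomial.sum]
      by_cases hm : m ∈ (p N).support
      · exact Finset.single_le_sum (f := fun e => (p N).coeff e) (fun _ _ => Nat.zero_le _) hm
      · rw [notMem_support_iff.mp hm]; exact Nat.zero_le _
    calc _ ≤ 4 ^ N := h1 ▸ h2
      _ < 4 ^ 60 := Nat.pow_lt_pow_right (by norm_num) hN
      _ = 2 ^ 120 := by norm_num
  have hF : ∀ N, (p (N + 1)).eval (2 ^ 120) = (p N).eval (2 ^ 120) *
      ((1 + (2 ^ 120) ^ (3 * N + 1)) * (1 + (2 ^ 120) ^ (3 * N + 2))) := by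
    intro N
    simp only [p, Finset.prod_range_succ, eval_mul, eval_add, eval_one, eval_pow, eval_X]
  have h0 : (p 0).eval (2 ^ 120) = 1 := by simp [p]
  have hc := windowCheck_spec (F := fun N => (p N).eval (2 ^ 120)) hF (M := 0) (fuel := 60)
    (by rw [h0]; exact windowCheck_sixty) (Nat.zero_le N) (by omega)
  have hsq : 3 * N ^ 2 + 3 = 3 * (N - 1) ^ 2 + 6 * N := by
    obtain ⟨k, rfl⟩ : ∃ k, N = k + 1 := ⟨N - 1, by omega⟩
    simp only [Nat.add_sub_cancel]; ring
  have par2 : 3 * N ^ 2 % 2 = N % 2 := by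
    rcases Nat.mod_two_eq_zero_or_one N with h | h <;> simp [Nat.mul_mod, Nat.pow_mod, h]
  obtain ⟨m, hm⟩ : ∃ m, 3 * N ^ 2 = 2 * m + 1 + y := ⟨(3 * N ^ 2 - 1 - y) / 2, by omega⟩
  -- The window y < 6N - 3 corresponds to exponents m from the middle of the previous product up to
  -- the middle of the current one.
  obtain ⟨i, rfl⟩ : ∃ i, m = 3 * (N - 1) ^ 2 / 2 + i := ⟨m - 3 * (N - 1) ^ 2 / 2, by omega⟩
  have hd := digitsMonotone_spec hc (i := i) (by omega)
  rw [Nat.div_div_eq_div_mul, Nat.div_div_eq_div_mul, ← pow_add, ← pow_add,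
    ← add_assoc] at hd
  have ev := eval_div_pow_mod_eq_coeff (2 ^ 120) (p N) hp2
  rw [ev, ev] at hd
  zify at hd
  rw [hp1, hp1] at hd
  zify at hm
  rw [← centeredCoeff_neg, ← centeredCoeff_neg N (y - 1)]
  convert hd using 2 <;> push_cast <;> linarith

/-! ### Fourier integral for the differences -/

/-- `∏_{k<N} cos((3k+1)θ) cos((3k+2)θ)`, with the factors in sum form. -/
noncomputable def cosProd (N : ℕ) (θ : ℝ) : ℝ :=
  ∏ j ∈ Finset.range N, (Real.cos θ + Real.cos ((6 * j + 3) * θ)) / 2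

theorem continuous_cosProd (N : ℕ) : Continuous (cosProd N) := by
  unfold cosProd
  fun_prop

theorem cosProd_pi_sub (N : ℕ) (θ : ℝ) : cosProd N (Real.pi - θ) = (-1) ^ N * cosProd N θ := by
  unfold cosProd
  rw [← Finset.card_range N, ← Finset.prod_const, Finset.card_range, ← Finset.prod_mul_distrib]
  refine Finset.prod_congr rfl fun j _ => ?_
  have : Real.cos ((6 * j + 3) * (Real.pi - θ)) = -Real.cos ((6 * j + 3) * θ) := by
    rw [show (6 * j + 3) * (Real.pi - θ) = Real.pi - (6 * j + 3) * θ + (3 * j + 1 : ℕ) * (2 * Real.pi) by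
      push_cast; ring, Real.cos_add_nat_mul_two_pi, Real.cos_pi_sub]
  rw [this, Real.cos_pi_sub]
  ring

theorem integral_cos_int_mul (x : ℤ) :
    ∫ θ in (0 : ℝ)..Real.pi, Real.cos (x * θ) = if x = 0 then Real.pi else 0 := by
  split_ifs with h
  · simp [h]
  · have hx : (x : ℝ) ≠ 0 := by exact_mod_cast h
    rw [intervalIntegral.integral_comp_mul_left (fun t => Real.cos t) hx, integral_cos]
    simp [Real.sin_int_mul_pi]

theorem pi_mul_centeredCoeff (N : ℕ) (x : ℤ) :
    Real.pi * centeredCoeff N x =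
      4 ^ N * ∫ θ in (0 : ℝ)..Real.pi, cosProd N θ * Real.cos (x * θ) := by
  induction N generalizing x with
  | zero => simp [centeredCoeff, cosProd, integral_cos_int_mul]
  | succ N ih =>
    have hc := continuous_cosProd N
    have int : ∀ z : ℤ, IntervalIntegrable (fun θ => cosProd N θ * Real.cos (z * θ))
        MeasureTheory.volume 0 Real.pi := fun z => by
      apply Continuous.intervalIntegrable
      fun_prop
    simp only [centeredCoeff]
    push_cast
    rw [mul_add, mul_add, mul_add, ih, ih, ih, ih, ← mul_add, ← mul_add, ← mul_add,
      ← intervalIntegral.integral_add (int _) (int _),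
      ← intervalIntegral.integral_add ((int _).add (int _)) (int _),
      ← intervalIntegral.integral_add (((int _).add (int _)).add (int _)) (int _),
      pow_succ, mul_assoc, ← intervalIntegral.integral_const_mul (4 : ℝ)]
    congr 1
    refine intervalIntegral.integral_congr fun θ _ => ?_
    simp only [cosProd, Finset.prod_range_succ]
    push_cast
    rw [show ((x : ℝ) + 1) * θ = x * θ + θ by ring, show ((x : ℝ) - 1) * θ = x * θ - θ by ring,
      show ((x : ℝ) + (6 * N + 3)) * θ = x * θ + (6 * N + 3) * θ by ring,
      show ((x : ℝ) - (6 * N + 3)) * θ = x * θ - (6 * N + 3) * θ by ring,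
      Real.cos_add, Real.cos_sub, Real.cos_add, Real.cos_sub]
    ring

theorem pi_mul_centeredCoeff_sub (N y : ℕ) :
    Real.pi * ((centeredCoeff N (y - 1) - centeredCoeff N (y + 1) : ℤ) : ℝ) =
      4 ^ N * (2 * ∫ θ in (0 : ℝ)..Real.pi, cosProd N θ * (Real.sin (y * θ) * Real.sin θ)) := by
  have hc := continuous_cosProd N
  have int : ∀ z : ℤ, IntervalIntegrable (fun θ => cosProd N θ * Real.cos (z * θ))
      MeasureTheory.volume 0 Real.pi := fun z => by
    apply Continuous.intervalIntegrable
    fun_prop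
  push_cast
  rw [mul_sub, pi_mul_centeredCoeff, pi_mul_centeredCoeff, ← mul_sub,
    ← intervalIntegral.integral_sub (int _) (int _), ← intervalIntegral.integral_const_mul (2 : ℝ)]
  congr 1
  refine intervalIntegral.integral_congr fun θ _ => ?_
  push_cast
  rw [show ((y : ℝ) + 1) * θ = y * θ + θ by ring, show ((y : ℝ) - 1) * θ = y * θ - θ by ring,
    Real.cos_add, Real.cos_sub]
  ring

/-- Under θ ↦ π - θ the integrand is multiplied by a constant sign, so the full integral is either
twice the half integral or zero. -/
theorem integral_zero_pi_nonneg_of_half (N y : ℕ)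
    (h : 0 ≤ ∫ θ in (0 : ℝ)..(Real.pi / 2), cosProd N θ * (Real.sin (y * θ) * Real.sin θ)) :
    0 ≤ ∫ θ in (0 : ℝ)..Real.pi, cosProd N θ * (Real.sin (y * θ) * Real.sin θ) := by
  set f : ℝ → ℝ := fun θ => cosProd N θ * (Real.sin (y * θ) * Real.sin θ) with hf
  have hc := continuous_cosProd N
  have int : ∀ a b, IntervalIntegrable f MeasureTheory.volume a b := fun a b => by
    apply Continuous.intervalIntegrable
    fun_prop
  have e1 : ∫ θ in (Real.pi / 2)..Real.pi, f θ = ∫ θ in (0 : ℝ)..(Real.pi / 2), f (Real.pi - θ) := by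
    rw [intervalIntegral.integral_comp_sub_left]
    congr 1 <;> ring
  have e2 : ∀ θ, f (Real.pi - θ) = (-1) ^ (N + y + 1) * f θ := by
    intro θ
    simp only [hf]
    rw [cosProd_pi_sub, Real.sin_pi_sub, mul_sub, Real.sin_nat_mul_pi_sub]
    ring
  rw [← intervalIntegral.integral_add_adjacent_intervals (int 0 (Real.pi / 2)) (int _ _), e1]
  simp_rw [e2]
  rw [intervalIntegral.integral_const_mul]
  rcases neg_one_pow_eq_or ℝ (N + y + 1) with h1 | h1 <;> rw [h1] <;> linarith

/-! ### Exponential bound away from 0 -/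

theorem sum_cos_odd_mul_two_sin (N : ℕ) (φ : ℝ) :
    (∑ j ∈ Finset.range N, Real.cos ((2 * j + 1) * φ)) * (2 * Real.sin φ) =
      Real.sin (2 * N * φ) := by
  induction N with
  | zero => simp
  | succ N ih =>
    rw [Finset.sum_range_succ, add_mul, ih]
    push_cast
    rw [show 2 * (N : ℝ) * φ = (2 * N + 1) * φ - φ by ring,
      show 2 * ((N : ℝ) + 1) * φ = (2 * N + 1) * φ + φ by ring, Real.sin_add, Real.sin_sub]
    ring

/-- The arithmetic-geometric mean bound for `cosProd`. -/
theorem abs_cosProd_le (N : ℕ) (hN : 0 < N) (θ c : ℝ)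
    (hc : Real.cos θ * ∑ j ∈ Finset.range N, Real.cos ((2 * j + 1) * (3 * θ)) ≤ 2 * N * c) :
    |cosProd N θ| ≤ (1 / 2 + c) ^ N := by
  have hN' : (N : ℝ) ≠ 0 := by positivity
  set q : ℕ → ℝ := fun j => (1 + Real.cos θ * Real.cos ((2 * j + 1) * (3 * θ))) / 2 with hq
  have hq0 : ∀ j, 0 ≤ q j := fun j => by
    have : |Real.cos θ * Real.cos ((2 * j + 1) * (3 * θ))| ≤ 1 := by
      rw [abs_mul]
      exact mul_le_one₀ (Real.abs_cos_le_one _) (abs_nonneg _) (Real.abs_cos_le_one _)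
    have := (abs_le.mp this).1
    simp only [hq]
    linarith
  have h1 : |cosProd N θ| ≤ ∏ j ∈ Finset.range N, q j := by
    rw [cosProd, Finset.abs_prod]
    refine Finset.prod_le_prod (fun _ _ => abs_nonneg _) fun j _ => ?_
    simp only [hq]
    rw [show (6 * (j : ℝ) + 3) * θ = (2 * j + 1) * (3 * θ) by ring]
    set a := Real.cos θ
    set b := Real.cos ((2 * j + 1) * (3 * θ))
    have ha := abs_le.mp (Real.abs_cos_le_one θ)
    have hb := abs_le.mp (Real.abs_cos_le_one ((2 * j + 1) * (3 * θ)))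
    rw [abs_le]
    -- |a + b| ≤ 1 + ab, from (1 - a)(1 - b) ≥ 0 and (1 + a)(1 + b) ≥ 0.
    constructor <;> nlinarith
  refine h1.trans ?_
  have h2 := Real.geom_mean_le_arith_mean_weighted (Finset.range N) (fun _ => 1 / (N : ℝ)) q
    (fun _ _ => by positivity) (by simp [hN']) (fun j _ => hq0 j)
  have h3 : ∏ j ∈ Finset.range N, q j =
      (∏ j ∈ Finset.range N, q j ^ (1 / (N : ℝ))) ^ N := by
    rw [← Finset.prod_pow]
    refine Finset.prod_congr rfl fun j _ => ?_
    rw [one_div, Real.rpow_inv_natCast_pow (hq0 j) hN.ne']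
  have h4 : ∑ j ∈ Finset.range N, 1 / (N : ℝ) * q j ≤ 1 / 2 + c := by
    simp only [hq]
    rw [← Finset.mul_sum, ← Finset.sum_div, Finset.sum_add_distrib, ← Finset.mul_sum]
    simp only [Finset.sum_const, Finset.card_range, nsmul_eq_mul, mul_one]
    rw [one_div_mul_eq_div, div_le_iff₀ (by positivity)]
    linarith
  rw [h3]
  exact pow_le_pow_left₀ (Finset.prod_nonneg fun j _ => Real.rpow_nonneg (hq0 j) _) (h2.trans h4) N

theorem abs_sum_cos_odd_le (N : ℕ) (hN : 0 < N) (s : ℝ) (h1 : Real.pi / N ≤ s)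
    (h2 : s ≤ Real.pi / 2) :
    |∑ j ∈ Finset.range N, Real.cos ((2 * j + 1) * s)| ≤ N / 4 := by
  have hN' : (0 : ℝ) < N := by positivity
  have hs : 0 < s := lt_of_lt_of_le (by positivity) h1
  have h3 : 2 / (N : ℝ) ≤ Real.sin s := by
    refine le_trans ?_ (Real.mul_le_sin hs.le h2)
    calc 2 / (N : ℝ) = 2 / Real.pi * (Real.pi / N) := by field_simp
      _ ≤ _ := by gcongr
  have h4 := sum_cos_odd_mul_two_sin N s
  set G := ∑ j ∈ Finset.range N, Real.cos ((2 * j + 1) * s)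
  have h5 : |G| * (2 * Real.sin s) ≤ 1 := by
    have : 0 ≤ 2 * Real.sin s := by linarith [show 0 ≤ 2 / (N : ℝ) by positivity]
    rw [← abs_of_nonneg this, ← abs_mul, h4]
    exact Real.abs_sin_le_one _
  have h6 : |G| * (2 * (2 / N)) ≤ 1 :=
    (mul_le_mul_of_nonneg_left (by linarith) (abs_nonneg G)).trans h5
  rw [show |G| * (2 * (2 / (N : ℝ))) = |G| * 4 / N by ring, div_le_one hN'] at h6
  linarith

/-- Lower bound for the Dirichlet-type sum in a neighbourhood of `0`. -/
theorem neg_le_sum_cos_odd_of_le (N : ℕ) (hN : 60 ≤ N) (s : ℝ) (h0 : 0 ≤ s)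
    (h1 : s ≤ Real.pi / N) :
    -(N / 3 : ℝ) ≤ ∑ j ∈ Finset.range N, Real.cos ((2 * j + 1) * s) := by
  have hN' : (60 : ℝ) ≤ N := by exact_mod_cast hN
  have hN0 : (0 : ℝ) < N := by linarith
  rcases h0.eq_or_lt with rfl | h0
  · simp; linarith
  have hpi := Real.pi_lt_d2
  have hpi' := Real.pi_gt_d2
  have hs : s ≤ 1 / 10 := by
    refine h1.trans ?_
    rw [div_le_iff₀ hN0]
    linarith
  have hsin : 99 / 100 * s ≤ Real.sin s := by
    have := Real.sin_gt_sub_cube h0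
    nlinarith [mul_pos h0 h0]
  have h4 := sum_cos_odd_mul_two_sin N s
  set G := ∑ j ∈ Finset.range N, Real.cos ((2 * j + 1) * s)
  by_contra! hG
  have hsp : 0 < Real.sin s := by linarith
  rcases le_or_gt (2 * N * s) Real.pi with h | h
  · have := Real.sin_nonneg_of_nonneg_of_le_pi (by positivity : 0 ≤ 2 * N * s) h
    nlinarith
  -- Here s > π/(2N), so the sum is at least -N/(0.99π), and 0.99π > 3.
  · have h5 := Real.neg_one_le_sin (2 * N * s)
    nlinarith

theorem cos_le_half_add (v : ℝ) : Real.cos ((Real.pi + v) / 3) ≤ 1 / 2 + |v| / 3 := by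
  rw [show (Real.pi + v) / 3 = Real.pi / 3 + v / 3 by ring, Real.cos_add, Real.cos_pi_div_three]
  have h1 := Real.cos_le_one (v / 3)
  have h2 : |Real.sin (Real.pi / 3) * Real.sin (v / 3)| ≤ 1 * |v / 3| := by
    rw [abs_mul]
    exact mul_le_mul (Real.abs_sin_le_one _) Real.abs_sin_le_abs (abs_nonneg _) zero_le_one
  rw [abs_div, abs_of_pos (three_pos : (0 : ℝ) < 3)] at h2
  linarith [(abs_le.mp h2).1]

theorem cos_mul_sum_cos_odd_le (N : ℕ) (hN : 60 ≤ N) (θ : ℝ) (h1 : Real.pi / (6 * N) ≤ θ)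
    (h2 : θ ≤ Real.pi / 2) :
    Real.cos θ * ∑ j ∈ Finset.range N, Real.cos ((2 * j + 1) * (3 * θ)) ≤ N / 4 := by
  have hN' : (60 : ℝ) ≤ N := by exact_mod_cast hN
  have hN0 : (0 : ℝ) < N := by linarith
  have hθ : 0 < θ := lt_of_lt_of_le (by positivity) h1
  have hc0 : 0 ≤ Real.cos θ := Real.cos_nonneg_of_neg_pi_div_two_le_of_le (by linarith) h2
  have hc1 := Real.cos_le_one θ
  rcases le_or_gt θ (Real.pi / 6) with h | h
  · rcases le_or_gt (Real.pi / N) (3 * θ) with h3 | h3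
    · have := (abs_le.mp (abs_sum_cos_odd_le N (by omega) (3 * θ) h3 (by linarith))).2
      nlinarith
    · have h4 := sum_cos_odd_mul_two_sin N (3 * θ)
      set G := ∑ j ∈ Finset.range N, Real.cos ((2 * j + 1) * (3 * θ))
      rw [div_le_iff₀ (by positivity)] at h1
      rw [lt_div_iff₀ hN0] at h3
      have h5 : 0 < Real.sin (3 * θ) := Real.sin_pos_of_pos_of_lt_pi (by positivity) (by linarith)
      -- Here 6Nθ lies in [π, 2π], which is why the tail starts at π/(6N).
      have h6 : Real.sin (2 * N * (3 * θ)) ≤ 0 := by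
        rw [← Real.sin_sub_two_pi]
        exact Real.sin_nonpos_of_nonpos_of_neg_pi_le (by linarith) (by linarith)
      have : G ≤ 0 := by
        by_contra! hG
        nlinarith [mul_pos hG h5]
      nlinarith
  -- Centering at π/3 reverses the sign of the sum. Near v = 0 the sum is only bounded by N/3, but
  -- the factor cos θ is then close to 1/2.
  · obtain ⟨v, rfl⟩ : ∃ v, θ = (Real.pi + v) / 3 := ⟨3 * θ - Real.pi, by ring⟩
    have hv : |v| ≤ Real.pi / 2 := abs_le.mpr ⟨by linarith, by linarith⟩
    have hG : ∑ j ∈ Finset.range N, Real.cos ((2 * j + 1) * (3 * ((Real.pi + v) / 3))) =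
        -∑ j ∈ Finset.range N, Real.cos ((2 * j + 1) * |v|) := by
      rw [← Finset.sum_neg_distrib]
      refine Finset.sum_congr rfl fun j _ => ?_
      rw [show (2 * (j : ℝ) + 1) * (3 * ((Real.pi + v) / 3)) =
        (2 * j + 1) * v + Real.pi + j * (2 * Real.pi) by ring, Real.cos_add_nat_mul_two_pi,
        Real.cos_add_pi, ← Real.cos_abs ((2 * j + 1) * v), abs_mul,
        abs_of_pos (by positivity : (0 : ℝ) < 2 * j + 1)]
    rw [hG]
    rcases le_or_gt (Real.pi / N) |v| with h3 | h3
    · have := (abs_le.mp (abs_sum_cos_odd_le N (by omega) |v| h3 hv)).1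
      nlinarith
    · have h4 := neg_le_sum_cos_odd_of_le N hN |v| (abs_nonneg v) h3.le
      have h5 := cos_le_half_add v
      have h6 : |v| ≤ 1 / 10 := by
        refine h3.le.trans ?_
        rw [div_le_iff₀ hN0]
        linarith [Real.pi_lt_d2]
      nlinarith

theorem abs_cosProd_le_of_tail (N : ℕ) (hN : 60 ≤ N) (θ : ℝ) (h1 : Real.pi / (6 * N) ≤ θ)
    (h2 : θ ≤ Real.pi / 2) : |cosProd N θ| ≤ (5 / 8) ^ N := by
  have h := abs_cosProd_le N (by omega) θ (1 / 8)
    ((cos_mul_sum_cos_odd_le N hN θ h1 h2).trans (by linarith))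
  norm_num at h ⊢
  exact h

/-! ### Lower bound near 0 and comparison with the tail -/

theorem cosProd_nonneg (N : ℕ) (θ : ℝ) (h0 : 0 ≤ θ) (h1 : 6 * N * θ ≤ Real.pi) :
    0 ≤ cosProd N θ := by
  refine Finset.prod_nonneg fun j hj => ?_
  have hj' : (j : ℝ) + 1 ≤ N := by exact_mod_cast Finset.mem_range.mp hj
  have : Real.cos (Real.pi - θ) ≤ Real.cos ((6 * j + 3) * θ) :=
    Real.cos_le_cos_of_nonneg_of_le_pi (by positivity) (by linarith) (by nlinarith)
  rw [Real.cos_pi_sub] at this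
  linarith

/-- Each factor is at least 1 - 9N²θ² by the quadratic bound for cosine; Bernoulli's inequality then
handles the product. -/
theorem le_cosProd (N : ℕ) (θ : ℝ) (h1 : 9 * N ^ 2 * θ ^ 2 ≤ 1) :
    1 - 9 * N ^ 3 * θ ^ 2 ≤ cosProd N θ := by
  have h2 := one_add_mul_le_pow (by linarith : -2 ≤ -(9 * (N : ℝ) ^ 2 * θ ^ 2)) N
  calc 1 - 9 * N ^ 3 * θ ^ 2 = 1 + N * -(9 * (N : ℝ) ^ 2 * θ ^ 2) := by ring
    _ ≤ _ := h2
    _ = ∏ j ∈ Finset.range N, (1 + -(9 * (N : ℝ) ^ 2 * θ ^ 2)) := by simp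
    _ ≤ cosProd N θ := by
      refine Finset.prod_le_prod (fun _ _ => by linarith) fun j hj => ?_
      have hj' : (j : ℝ) + 1 ≤ N := by exact_mod_cast Finset.mem_range.mp hj
      have c1 := Real.one_sub_sq_div_two_le_cos (x := θ)
      have c2 := Real.one_sub_sq_div_two_le_cos (x := (6 * j + 3) * θ)
      have hj0 : (0 : ℝ) ≤ j := j.cast_nonneg
      have h3 : 1 + (6 * (j : ℝ) + 3) ^ 2 ≤ 36 * N ^ 2 := by nlinarith
      nlinarith [mul_le_mul_of_nonneg_right h3 (sq_nonneg θ)]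

/-- Tail against main contribution: 2 bounds the length of the tail interval, and 1/N² is the length
of [1/N², 2/N²]. -/
theorem two_mul_five_eighths_pow_le (N : ℕ) (hN : 60 ≤ N) :
    2 * (5 / 8 : ℝ) ^ N ≤ 3 / 10 * (1 / N ^ 4) * (1 / N ^ 2) := by
  suffices h : (N : ℝ) ^ 6 * (5 / 8) ^ N ≤ 3 / 20 by
    have hN' : (0 : ℝ) < N := by exact_mod_cast (by omega : 0 < N)
    rw [show 3 / 10 * (1 / (N : ℝ) ^ 4) * (1 / N ^ 2) = 3 / 10 / N ^ 6 by field_simp,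
      le_div_iff₀ (by positivity)]
    linarith
  induction N, hN using Nat.le_induction with
  | base => norm_num
  | succ N hN ih =>
    have hN' : (60 : ℝ) ≤ N := by exact_mod_cast hN
    have h1 : ((N : ℝ) + 1) ^ 6 * (5 / 8) ≤ (N : ℝ) ^ 6 := by
      have : ((N : ℝ) + 1) ^ 6 ≤ (61 / 60 * (N : ℝ)) ^ 6 := by
        gcongr
        linarith
      calc ((N : ℝ) + 1) ^ 6 * (5 / 8) ≤ (61 / 60 * (N : ℝ)) ^ 6 * (5 / 8) := by gcongr
        _ = ((61 / 60) ^ 6 * (5 / 8)) * (N : ℝ) ^ 6 := by ring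
        _ ≤ 1 * (N : ℝ) ^ 6 := by gcongr; norm_num
        _ = (N : ℝ) ^ 6 := one_mul _
    calc ((N + 1 : ℕ) : ℝ) ^ 6 * (5 / 8) ^ (N + 1)
        = ((N : ℝ) + 1) ^ 6 * (5 / 8) * (5 / 8) ^ N := by push_cast; ring
      _ ≤ (N : ℝ) ^ 6 * (5 / 8) ^ N := by gcongr
      _ ≤ _ := ih

theorem le_sin_of_le_fifth {x : ℝ} (h0 : 0 < x) (h1 : x ≤ 1 / 5) : 9 / 10 * x ≤ Real.sin x := by
  have := Real.sin_gt_sub_cube h0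
  nlinarith [mul_pos h0 h0]

theorem integrand_lower_bound (N y : ℕ) (hN : 60 ≤ N) (hy : 1 ≤ y) (hyN : y < 6 * N) (θ : ℝ)
    (h1 : 1 / (N : ℝ) ^ 2 ≤ θ) (h2 : θ ≤ 2 / (N : ℝ) ^ 2) :
    3 / 10 * (1 / (N : ℝ) ^ 4) ≤ cosProd N θ * (Real.sin (y * θ) * Real.sin θ) := by
  have hN' : (60 : ℝ) ≤ N := by exact_mod_cast hN
  have hN0 : (0 : ℝ) < N := by linarith
  have hy1 : (1 : ℝ) ≤ y := by exact_mod_cast hy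
  have hy2 : (y : ℝ) ≤ 6 * N := by exact_mod_cast hyN.le
  have hθ : 0 < θ := lt_of_lt_of_le (by positivity) h1
  have hNθ : N * θ ≤ 2 / N := by
    calc N * θ ≤ N * (2 / (N : ℝ) ^ 2) := by gcongr
      _ = 2 / N := by field_simp
  have hN30 : 2 / (N : ℝ) ≤ 1 / 30 := by
    rw [div_le_iff₀ hN0]; linarith
  have hyθ : y * θ ≤ 1 / 5 := by nlinarith
  have hθ5 : θ ≤ 1 / 5 := by nlinarith
  have s1 := le_sin_of_le_fifth hθ hθ5
  have s2 := le_sin_of_le_fifth (by positivity : 0 < y * θ) hyθ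
  have hsq : (N * θ) ^ 2 ≤ (2 / N) ^ 2 := by gcongr
  have c := le_cosProd N θ (by nlinarith [mul_pos hN0 hθ])
  have c' : 2 / 5 ≤ cosProd N θ := by
    refine le_trans ?_ c
    have : 9 * (N : ℝ) ^ 3 * θ ^ 2 ≤ 9 * N * (2 / N) ^ 2 := by
      calc 9 * (N : ℝ) ^ 3 * θ ^ 2 = 9 * N * (N * θ) ^ 2 := by ring
        _ ≤ _ := by gcongr
    have e : 9 * (N : ℝ) * (2 / N) ^ 2 = 18 * (2 / N) := by field_simp; norm_num
    linarith
  have hθ4 : 1 / (N : ℝ) ^ 4 ≤ θ ^ 2 := by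
    calc 1 / (N : ℝ) ^ 4 = (1 / (N : ℝ) ^ 2) ^ 2 := by field_simp
      _ ≤ θ ^ 2 := by gcongr
  have s3 : 9 / 10 * θ ≤ Real.sin (y * θ) := by nlinarith
  calc 3 / 10 * (1 / (N : ℝ) ^ 4) ≤ 3 / 10 * θ ^ 2 := by gcongr
    _ ≤ 2 / 5 * ((9 / 10 * θ) * (9 / 10 * θ)) := by nlinarith [sq_nonneg θ]
    _ ≤ _ := by
      gcongr
      linarith

theorem half_integral_nonneg (N y : ℕ) (hN : 60 ≤ N) (hy : 1 ≤ y) (hyN : y < 6 * N) :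
    0 ≤ ∫ θ in (0 : ℝ)..(Real.pi / 2), cosProd N θ * (Real.sin (y * θ) * Real.sin θ) := by
  set f : ℝ → ℝ := fun θ => cosProd N θ * (Real.sin (y * θ) * Real.sin θ) with hf
  have hN' : (60 : ℝ) ≤ N := by exact_mod_cast hN
  have hN0 : (0 : ℝ) < N := by linarith
  have hy2 : (y : ℝ) ≤ 6 * N := by exact_mod_cast hyN.le
  have hpi := Real.pi_gt_three
  have hpi4 := Real.pi_le_four
  have hc := continuous_cosProd N
  have int : ∀ a b, IntervalIntegrable f MeasureTheory.volume a b := fun a b => by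
    apply Continuous.intervalIntegrable
    fun_prop
  have hA1 : 2 / (N : ℝ) ^ 2 ≤ Real.pi / (6 * N) := by
    rw [div_le_div_iff₀ (by positivity) (by positivity)]
    nlinarith
  have hA2 : Real.pi / (6 * N) ≤ Real.pi / 2 := by
    gcongr
    linarith
  have h12 : 1 / (N : ℝ) ^ 2 ≤ 2 / (N : ℝ) ^ 2 := by gcongr; norm_num
  have hpos : ∀ θ, 0 ≤ θ → θ ≤ Real.pi / (6 * N) → 0 ≤ f θ := by
    intro θ h0 h1
    rw [le_div_iff₀ (by positivity)] at h1
    have h2 : y * θ ≤ Real.pi := by nlinarith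
    exact mul_nonneg (cosProd_nonneg N θ h0 (by linarith)) (mul_nonneg
      (Real.sin_nonneg_of_nonneg_of_le_pi (by positivity) h2)
      (Real.sin_nonneg_of_nonneg_of_le_pi h0 (by nlinarith)))
  have i1 : 0 ≤ ∫ θ in (0 : ℝ)..(1 / (N : ℝ) ^ 2), f θ :=
    intervalIntegral.integral_nonneg (by positivity) fun θ h => hpos θ h.1 (by linarith [h.2])
  have i3 : 0 ≤ ∫ θ in (2 / (N : ℝ) ^ 2)..(Real.pi / (6 * N)), f θ :=
    intervalIntegral.integral_nonneg hA1 fun θ h =>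
      hpos θ (le_trans (by positivity) h.1) h.2
  have i2 : 3 / 10 * (1 / (N : ℝ) ^ 4) * (1 / N ^ 2) ≤
      ∫ θ in (1 / (N : ℝ) ^ 2)..(2 / (N : ℝ) ^ 2), f θ := by
    have := intervalIntegral.integral_mono_on h12
      (intervalIntegrable_const (c := 3 / 10 * (1 / (N : ℝ) ^ 4))) (int _ _)
      fun θ h => integrand_lower_bound N y hN hy hyN θ h.1 h.2
    rw [intervalIntegral.integral_const, smul_eq_mul] at this
    refine le_trans (le_of_eq ?_) this
    ring
  have i4 : |∫ θ in (Real.pi / (6 * N))..(Real.pi / 2), f θ| ≤ 2 * (5 / 8 : ℝ) ^ N := by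
    have := intervalIntegral.norm_integral_le_of_norm_le_const (f := f) (C := (5 / 8 : ℝ) ^ N)
      (a := Real.pi / (6 * N)) (b := Real.pi / 2) (fun θ h => by
        rw [Set.uIoc_of_le hA2] at h
        have hb := abs_cosProd_le_of_tail N hN θ h.1.le h.2
        rw [hf, Real.norm_eq_abs, abs_mul, abs_mul]
        calc _ ≤ (5 / 8 : ℝ) ^ N * (1 * 1) := by
              gcongr
              · exact Real.abs_sin_le_one _
              · exact Real.abs_sin_le_one _
          _ = _ := by ring)
    rw [Real.norm_eq_abs] at this
    refine this.trans ?_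
    rw [mul_comm]
    gcongr
    rw [abs_of_nonneg (by linarith)]
    have : 0 ≤ Real.pi / (6 * N) := by positivity
    linarith
  have h5 := two_mul_five_eighths_pow_le N hN
  have h6 := (abs_le.mp i4).1
  rw [← intervalIntegral.integral_add_adjacent_intervals (int 0 (1 / (N : ℝ) ^ 2)) (int _ _),
    ← intervalIntegral.integral_add_adjacent_intervals
      (int (1 / (N : ℝ) ^ 2) (2 / (N : ℝ) ^ 2)) (int _ _),
    ← intervalIntegral.integral_add_adjacent_intervals
      (int (2 / (N : ℝ) ^ 2) (Real.pi / (6 * N))) (int _ _)]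
  linarith

theorem centeredCoeff_window_of_sixty_le (N y : ℕ) (hN : 60 ≤ N) (hy : 1 ≤ y) (hyN : y < 6 * N) :
    centeredCoeff N (y + 1) ≤ centeredCoeff N (y - 1) := by
  have h1 := integral_zero_pi_nonneg_of_half N y (half_integral_nonneg N y hN hy hyN)
  have h2 := pi_mul_centeredCoeff_sub N y
  have h3 : 0 ≤ Real.pi * ((centeredCoeff N (y - 1) - centeredCoeff N (y + 1) : ℤ) : ℝ) := by
    rw [h2]
    positivity
  have h4 := nonneg_of_mul_nonneg_right h3 Real.pi_pos
  have h5 : 0 ≤ centeredCoeff N (y - 1) - centeredCoeff N (y + 1) := by exact_mod_cast h4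
  linarith

theorem theorem1 (n : ℕ) :
    (partitionPoly n).natDegree = 3 * (n + 1) ^ 2 ∧
      SymmetricPoly (partitionPoly n) ∧ UnimodalPoly (partitionPoly n) := by
  refine theorem1_of_window (fun N y hy hyN => ?_) n
  rcases lt_or_ge N 60 with hN | hN
  · exact centeredCoeff_window_of_lt_sixty N y hN hy hyN
  · exact centeredCoeff_window_of_sixty_le N y hN hy (by omega)
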